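/- Let $\chi_1,\chi_2$ be primitive Dirichlet characters modulo $q_1,q_2>1$ with $\chi_1(-1)\chi_2(-1)=1$, and let $\psi=\chi_1\overline{\chi_2}$. For $z$ in the upper half-plane put $$f_{\chi_1,\chi_2}(z)=\sum_{n\ge1}\frac{\lambda(n)}{\sqrt n}\,e^{2\pi i n z},\qquad \lambda(n)=\sum_{AB=n}\chi_1(A)\overline{\chi_2}(B)\Big(\frac BA\Big)^{1/2}.$$ For $\gamma=\begin{pmatrix}a&b\\c&d\end{pmatrix}\in\Gamma_0(q_1q_2)$, the newform Dedekind sum $S_{\chi_1,\chi_2}(\gamma)\in\mathbb C$ is the constant determined by $$\frac{\pi i}{\tau(\overline{\chi_1})}\,S_{\chi_1,\chi_2}(\gamma)=f_{\chi_1,\chi_2}(\gamma z)-\psi(d)\,f_{\chi_1,\chi_2}(z)\qquad\text{for all } z \text{ in the upper half-plane},$$ where $\tau(\chi)=\sum_{n \bmod q}\chi(n)e^{2\pi i n/q}$ is the Gauss sum of a character $\chi$ modulo $q$. It depends only on the first column of $\gamma$ and is also written $S_{\chi_1,\chi_2}(a,c)$. Let $(a,c)$ be the first column of a matrix in $\Gamma_0(q_1q_2)$.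 If $a^2\equiv-1 \pmod c$ and $\psi(a)=1$, then $S_{\chi_1,\chi_2}(a,c)=0$. Likewise, if $a^2\equiv 1\pmod c$ and $\psi(a)=-\chi_2(-1)$, then $S_{\chi_1,\chi_2}(a,c)=0$. -/

import Mathlib

open scoped MatrixGroups UpperHalfPlane

noncomputable section

/-- The Fourier coefficient `λ_{χ₁,χ₂}(n, s) = ∑_{ab = n} χ₁(a) χ̄₂(b) (b/a)^{s - 1/2}` of the newform
Eisenstein series for positive `n` (where the sign factor `χ₂(sgn n)` equals `1`). The conjugate of
a Dirichlet character `χ` is its inverse `χ⁻¹` in the group of Dirichlet characters. -/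
def newformLambda {q₁ q₂ : ℕ} (χ₁ : DirichletCharacter ℂ q₁) (χ₂ : DirichletCharacter ℂ q₂)
    (n : ℕ+) (s : ℂ) : ℂ :=
  ∑ p ∈ (n : ℕ).divisorsAntidiagonal,
    χ₁ (p.1 : ZMod q₁) * χ₂⁻¹ (p.2 : ZMod q₂) * ((p.2 : ℂ) / (p.1 : ℂ)) ^ (s - 1 / 2)

/-- The holomorphic part `f_{χ₁,χ₂}(z) = ∑_{n ≥ 1} λ_{χ₁,χ₂}(n, 1) / √n · e^{2πinz}` of the newform
Eisenstein series at `s = 1`. -/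
def newformF {q₁ q₂ : ℕ} (χ₁ : DirichletCharacter ℂ q₁) (χ₂ : DirichletCharacter ℂ q₂)
    (z : ℍ) : ℂ :=
  ∑' n : ℕ+, newformLambda χ₁ χ₂ n 1 / (Real.sqrt (n : ℝ) : ℂ) *
    Complex.exp (2 * Real.pi * Complex.I * (n : ℂ) * (z : ℂ))

/-- The function `ψ = χ₁ χ̄₂` on the integers. -/
def newformPsi {q₁ q₂ : ℕ} (χ₁ : DirichletCharacter ℂ q₁) (χ₂ : DirichletCharacter ℂ q₂)
    (n : ℤ) : ℂ :=
  χ₁ (n : ZMod q₁) * χ₂⁻¹ (n : ZMod q₂)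

/-- `s` is the value `S_{χ₁,χ₂}(γ)` of the newform Dedekind sum at `γ = (a b; c d)`: the identity
`πi / τ(χ̄₁) · s = f_{χ₁,χ₂}(γ z) - ψ(d) f_{χ₁,χ₂}(z)` holds at every point `z` of the upper
half-plane. Here `τ(χ) = ∑_{n mod q} χ(n) e^{2πin/q}` is the standard Gauss sum. -/
def IsNewformDedekindSum {q₁ q₂ : ℕ} [NeZero q₁] (χ₁ : DirichletCharacter ℂ q₁)
    (χ₂ : DirichletCharacter ℂ q₂) (γ : SL(2, ℤ)) (s : ℂ) : Prop :=
  ∀ z : ℍ, (Real.pi * Complex.I) / gaussSum χ₁⁻¹ ZMod.stdAddChar * s =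
    newformF χ₁ χ₂ (γ • z) - newformPsi χ₁ χ₂ (γ 1 1) * newformF χ₁ χ₂ z

end

/-! Write `f` for `newformF` and `J` for the reflection `z ↦ -z̄`. The function `f(z) + χ₂(-1)
f(Jz)` is, up to a nonzero constant, the value at the edge of convergence of a weight-zero
Eisenstein series twisted by `χ₁`, `χ₂` (`tsum_regBlock_zero`), so it transforms under `Γ₀(q₁q₂)` by
`ψ(d)` (`newformF_add_reflection_smul`). Hence `f(γz) - ψ(d) f(z)` is both holomorphic and
antiholomorphic, so it is a constant `s`; the same identity shows that the conjugate of `γ` by `J`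
has constant `-χ₂(-1) s` (`exists_newformF_cocycle`).

Since `f` has period one, these constants are unchanged under translations on either side. If `a² ≡
-1` mod `c`, then `γ⁻¹` equals `γ` up to translations and sign; if `a² ≡ 1`, it equals the reflected
matrix in the same sense. Comparing with the constant of the inverse (`newformF_cocycle_relation`)
gives `s = -s` under the respective condition on `ψ(a)`.

The Eisenstein series is only conditionally convergent, so invariance is proved for an absolutely
convergent regularization and passed to the limit `ε → 0⁺` by dominated convergence, after grouping
terms into blocks on which `χ₂` sums to zero. -/

open scoped MatrixGroups UpperHalfPlane

/-! ### The regularized Eisenstein series and its transformation law -/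

/-- The quadratic form `|m N z + n|² / Im z` of the lattice spanned by `N z` and `1`. -/
noncomputable def latticeForm (N : ℕ) (z : ℍ) (p : ℤ × ℤ) : ℝ :=
  Complex.normSq (p.1 * N * z + p.2) / z.im

/-- A regularization of `1 / t`, decaying like `1 / (ε t²)`. -/
noncomputable def regInv (ε t : ℝ) : ℝ := 1 / (t * (1 + ε * t))

/-- The regularized Eisenstein series of weight zero attached to a pair of characters. -/
noncomputable def regEisenstein {q₁ q₂ : ℕ} (χ₁ : DirichletCharacter ℂ q₁)
    (χ₂ : DirichletCharacter ℂ q₂) (ε : ℝ) (z : ℍ) : ℂ :=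
  ∑' p : ℤ × ℤ, χ₁ p.1 * χ₂ p.2 * (regInv ε (latticeForm q₂ z p) : ℂ)

/-- Right multiplication by the integral matrix `(a, b; c, d)` of determinant one. -/
def intPairEquiv (a b c d : ℤ) (h : a * d - b * c = 1) : ℤ × ℤ ≃ ℤ × ℤ where
  toFun p := (p.1 * a + p.2 * c, p.1 * b + p.2 * d)
  invFun p := (p.1 * d - p.2 * c, p.2 * a - p.1 * b)
  left_inv p := by
    ext
    · linear_combination p.1 * h
    · linear_combination p.2 * h
  right_inv p := by
    ext
    · linear_combination p.1 * h
    · linear_combination p.2 * h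

lemma SL2Z_det_eq (γ : SL(2, ℤ)) : γ 0 0 * γ 1 1 - γ 0 1 * γ 1 0 = 1 := by
  have := γ.det_coe
  rwa [Matrix.det_fin_two] at this

lemma SL2Z_denom_ne_zero (γ : SL(2, ℤ)) (z : ℍ) : ((γ 1 0 : ℤ) * (z : ℂ) + (γ 1 1 : ℤ)) ≠ 0 := by
  have := UpperHalfPlane.denom_ne_zero γ z
  rwa [ModularGroup.denom_apply] at this

lemma SL2Z_coe_smul (γ : SL(2, ℤ)) (z : ℍ) :
    ((γ • z : ℍ) : ℂ) = ((γ 0 0 : ℤ) * (z : ℂ) + (γ 0 1 : ℤ)) / ((γ 1 0 : ℤ) * (z : ℂ) + (γ 1 1 : ℤ)) := by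
  rw [UpperHalfPlane.coe_specialLinearGroup_apply]
  simp

/-- Acting on `z` by `γ` amounts to acting on the lattice coordinates by the conjugate `(a, Nb; c/N,
d)`, which is integral because `N` divides the lower left entry. -/
lemma latticeForm_smul (N : ℕ) (γ : SL(2, ℤ)) (c : ℤ) (hc : γ 1 0 = N * c) (z : ℍ)
    (h : γ 0 0 * γ 1 1 - N * γ 0 1 * c = 1) (p : ℤ × ℤ) :
    latticeForm N (γ • z) p =
      latticeForm N z (intPairEquiv (γ 0 0) (N * γ 0 1) c (γ 1 1) h p) := by
  have hd := SL2Z_denom_ne_zero γ z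
  have him : (γ • z).im = z.im / Complex.normSq ((γ 1 0 : ℤ) * (z : ℂ) + (γ 1 1 : ℤ)) := by
    rw [ModularGroup.im_smul_eq_div_normSq, ModularGroup.denom_apply]
  unfold latticeForm
  rw [him, SL2Z_coe_smul]
  have : ((p.1 : ℂ) * N * (((γ 0 0 : ℤ) * (z : ℂ) + (γ 0 1 : ℤ)) / ((γ 1 0 : ℤ) * (z : ℂ) + (γ 1 1 : ℤ)))
      + p.2) = (((intPairEquiv (γ 0 0) (N * γ 0 1) c (γ 1 1) h p).1 : ℂ) * N * z +
        (intPairEquiv (γ 0 0) (N * γ 0 1) c (γ 1 1) h p).2) /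
          ((γ 1 0 : ℤ) * (z : ℂ) + (γ 1 1 : ℤ)) := by
    rw [eq_div_iff hd, add_mul, mul_assoc, mul_assoc, div_mul_cancel₀ _ hd]
    simp only [intPairEquiv, Equiv.coe_fn_mk, hc]
    push_cast
    ring
  rw [this, map_div₀]
  rw [div_div_div_cancel_right₀ (Complex.normSq_pos.mpr hd).ne']

lemma DirichletCharacter.apply_mul_apply_of_mul_eq_one {q : ℕ} (χ : DirichletCharacter ℂ q)
    {a d : ZMod q} (h : a * d = 1) : χ a * χ d = 1 := by
  rw [← map_mul, h, map_one]

lemma regEisenstein_smul {q₁ q₂ : ℕ} (χ₁ : DirichletCharacter ℂ q₁)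
    (χ₂ : DirichletCharacter ℂ q₂) {γ : SL(2, ℤ)}
    (hγ : γ ∈ CongruenceSubgroup.Gamma0 (q₁ * q₂)) (ε : ℝ) (z : ℍ) :
    regEisenstein χ₁ χ₂ ε (γ • z) = newformPsi χ₁ χ₂ (γ 1 1) * regEisenstein χ₁ χ₂ ε z := by
  rw [CongruenceSubgroup.Gamma0_mem, ZMod.intCast_zmod_eq_zero_iff_dvd] at hγ
  obtain ⟨c, hc⟩ := hγ
  have hc' : γ 1 0 = q₂ * (q₁ * c) := by rw [hc]; push_cast; ring
  have hdet := SL2Z_det_eq γ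
  have h : γ 0 0 * γ 1 1 - q₂ * γ 0 1 * (q₁ * c) = 1 := by
    rw [hc'] at hdet; linear_combination hdet
  have h₁ : ((γ 0 0 : ℤ) : ZMod q₁) * (γ 1 1 : ℤ) = 1 := by
    have := congrArg (Int.cast : ℤ → ZMod q₁) h
    push_cast at this
    simpa using this
  have h₂ : ((γ 0 0 : ℤ) : ZMod q₂) * (γ 1 1 : ℤ) = 1 := by
    have := congrArg (Int.cast : ℤ → ZMod q₂) h
    push_cast at this
    simpa using this
  have hχ₁ := χ₁.apply_mul_apply_of_mul_eq_one h₁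
  have hχ₂ : χ₂⁻¹ ((γ 1 1 : ℤ) : ZMod q₂) * χ₂ ((γ 1 1 : ℤ) : ZMod q₂) = 1 := by
    rw [← MulChar.mul_apply, inv_mul_cancel,
      MulChar.one_apply (IsUnit.of_mul_eq_one_right _ h₂)]
  unfold regEisenstein
  rw [← (intPairEquiv (γ 0 0) (q₂ * γ 0 1) (q₁ * c) (γ 1 1) h).tsum_eq
    (fun p ↦ χ₁ p.1 * χ₂ p.2 * (regInv ε (latticeForm q₂ z p) : ℂ)), ← tsum_mul_left]
  refine tsum_congr fun p ↦ ?_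
  rw [latticeForm_smul q₂ γ (q₁ * c) hc' z h]
  simp only [intPairEquiv, Equiv.coe_fn_mk, newformPsi]
  push_cast
  -- The new coordinates reduce to `m a` mod `q₁` and `n d` mod `q₂`, so the characters separate and
  -- only `ψ(d)` remains.
  simp only [CharP.cast_eq_zero, zero_mul, mul_zero, add_zero, zero_add, map_mul]
  linear_combination (-χ₁ p.1 * χ₂ p.2 * (regInv ε (latticeForm q₂ z
    (p.1 * γ 0 0 + p.2 * (q₁ * c), p.1 * (q₂ * γ 0 1) + p.2 * γ 1 1)) : ℂ)) *
      (hχ₁ * (χ₂⁻¹ ((γ 1 1 : ℤ) : ZMod q₂) * χ₂ ((γ 1 1 : ℤ) : ZMod q₂)) + hχ₂)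

/-! ### Estimates uniform in the regularization parameter -/

lemma Fin.sum_natCast_zmod {N : ℕ} [NeZero N] {M : Type*} [AddCommMonoid M] (f : ZMod N → M) :
    ∑ r : Fin N, f ((r : ℕ) : ZMod N) = ∑ x : ZMod N, f x := by
  obtain ⟨n, rfl⟩ := Nat.exists_eq_succ_of_ne_zero (NeZero.ne N)
  refine Finset.sum_congr rfl fun r _ ↦ ?_
  congr 1
  exact Fin.cast_val_eq_self (n := n + 1) r

lemma regInv_zero_left (t : ℝ) : regInv 0 t = 1 / t := by simp [regInv]

/-- The two differences have quotient `(1 + ε(t + t')) / ((1 + εt)(1 + εt'))`, which is at most one.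
This makes the later bounds independent of `ε`. -/
lemma abs_regInv_sub_le {ε t t' : ℝ} (hε : 0 ≤ ε) (ht : 0 < t) (ht' : 0 < t') :
    |regInv ε t - regInv ε t'| ≤ |1 / t - 1 / t'| := by
  have h₁ : 0 < 1 + ε * t := by positivity
  have h₂ : 0 < 1 + ε * t' := by positivity
  have h : regInv ε t - regInv ε t' =
      (1 / t - 1 / t') * ((1 + ε * (t + t')) / ((1 + ε * t) * (1 + ε * t'))) := by
    unfold regInv
    field_simp
    ring
  rw [h, abs_mul]
  refine mul_le_of_le_one_right (abs_nonneg _) ?_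
  rw [abs_of_nonneg (by positivity), div_le_one (by positivity)]
  nlinarith [mul_nonneg (mul_nonneg hε hε) (mul_pos ht ht').le]

lemma abs_inv_sq_sub_inv_sq_le {u v ℓ δ : ℝ} (hδ : 0 < δ) (hu : δ ≤ u) (hv : δ ≤ v)
    (huv : |u - v| ≤ ℓ) : |1 / u ^ 2 - 1 / v ^ 2| ≤ 2 * ℓ / δ ^ 3 := by
  have hu0 : 0 < u := hδ.trans_le hu
  have hv0 : 0 < v := hδ.trans_le hv
  have h : 1 / u ^ 2 - 1 / v ^ 2 = -((u - v) * (1 / (u * v ^ 2) + 1 / (u ^ 2 * v))) := by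
    field_simp
    ring
  have h₁ : 1 / (u * v ^ 2) ≤ 1 / δ ^ 3 := by
    apply one_div_le_one_div_of_le (by positivity)
    calc δ ^ 3 = δ * δ ^ 2 := by ring
      _ ≤ u * v ^ 2 := by gcongr
  have h₂ : 1 / (u ^ 2 * v) ≤ 1 / δ ^ 3 := by
    apply one_div_le_one_div_of_le (by positivity)
    calc δ ^ 3 = δ ^ 2 * δ := by ring
      _ ≤ u ^ 2 * v := by gcongr
  rw [h, abs_neg, abs_mul, abs_of_nonneg (a := _ + _) (by positivity)]
  calc |u - v| * (1 / (u * v ^ 2) + 1 / (u ^ 2 * v)) ≤ ℓ * (1 / δ ^ 3 + 1 / δ ^ 3) := by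
        gcongr
        exact (abs_nonneg _).trans huv
    _ = 2 * ℓ / δ ^ 3 := by ring

/-- A shift by `r ≤ N` costs at most `N` in norm, and for `m ≠ 0` the imaginary part already has
size at least `N Im z`. So the shift costs only the factor `Im z / (1 + Im z)`. -/
lemma exists_le_norm_lattice_add (N : ℕ) [NeZero N] (z : ℍ) : ∃ κ > 0, ∀ m k : ℤ, m ≠ 0 →
    ∀ r : Fin N, κ * ‖![m, k]‖ ≤ ‖(m : ℂ) * N * z + ((k * N + r : ℤ) : ℂ)‖ := by
  have hy := z.im_pos
  have hN : (1 : ℝ) ≤ N := by exact_mod_cast NeZero.one_le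
  have hρ := EisensteinSeries.r_pos z
  refine ⟨EisensteinSeries.r z * (z.im / (1 + z.im)), by positivity, fun m k hm r ↦ ?_⟩
  set w : ℂ := (m : ℂ) * N * z + ((k * N : ℤ) : ℂ) with hw
  have hx : ![m, k] ≠ 0 := fun h ↦ hm (by simpa using congrFun h 0)
  have h₁ : EisensteinSeries.r z * ‖![m, k]‖ ≤ ‖w‖ := by
    have h := EisensteinSeries.r_mul_max_le z hx
    have hw' : w = N * (m * (z : ℂ) + k) := by rw [hw]; push_cast; ring
    rw [hw', norm_mul, Complex.norm_natCast]
    refine h.trans ?_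
    simp only [Matrix.cons_val_zero, Matrix.cons_val_one]
    exact le_mul_of_one_le_left (norm_nonneg _) hN
  have h₂ : (m : ℂ) * N * z + ((k * N + r : ℤ) : ℂ) = w + (r : ℕ) := by
    rw [hw]; push_cast; ring
  rw [h₂]
  have h₃ : N * z.im ≤ ‖w + (r : ℕ)‖ := by
    refine le_trans ?_ (Complex.abs_im_le_norm _)
    have him : (w + (r : ℕ)).im = m * (N * z.im) := by
      simp [hw, mul_assoc]
    rw [him, abs_mul, abs_of_nonneg (a := N * z.im) (by positivity)]
    refine le_mul_of_one_le_left (by positivity) ?_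
    exact_mod_cast Int.one_le_abs hm
  have h₄ : ‖w‖ ≤ ‖w + (r : ℕ)‖ + N := by
    have h := norm_sub_le (w + (r : ℕ)) ((r : ℕ) : ℂ)
    rw [add_sub_cancel_right, Complex.norm_natCast] at h
    have : ((r : ℕ) : ℝ) ≤ N := by exact_mod_cast r.2.le
    linarith
  have h₅ : z.im / (1 + z.im) * ‖w‖ ≤ ‖w + (r : ℕ)‖ := by
    rw [div_mul_eq_mul_div, div_le_iff₀ (by positivity)]
    nlinarith
  calc _ = z.im / (1 + z.im) * (EisensteinSeries.r z * ‖![m, k]‖) := by ring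
    _ ≤ z.im / (1 + z.im) * ‖w‖ := by gcongr
    _ ≤ _ := h₅

lemma latticeForm_eq (N : ℕ) (z : ℍ) (m n : ℤ) :
    latticeForm N z (m, n) = ‖(m : ℂ) * N * z + n‖ ^ 2 / z.im := by
  rw [latticeForm, Complex.normSq_eq_norm_sq]

lemma latticeForm_pos (N : ℕ) [NeZero N] (z : ℍ) {m : ℤ} (hm : m ≠ 0) (n : ℤ) :
    0 < latticeForm N z (m, n) := by
  refine div_pos (Complex.normSq_pos.mpr fun h ↦ ?_) z.im_pos
  have := congrArg Complex.im h
  simp [hm, NeZero.ne N, z.im_ne_zero, mul_assoc] at this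

/-- Within a block, `1/|w|²` varies by `O(|w|⁻³)`; cubic decay is what makes a sum over `ℤ²`
converge. -/
lemma exists_abs_regInv_latticeForm_sub_le (N : ℕ) [NeZero N] (z : ℍ) : ∃ C : ℝ, ∀ ε ≥ 0,
    ∀ m k : ℤ, m ≠ 0 → ∀ r : Fin N, |regInv ε (latticeForm N z (m, k * N + r)) -
      regInv ε (latticeForm N z (m, k * N))| ≤ C * ‖![m, k]‖ ^ (-3 : ℝ) := by
  obtain ⟨κ, hκ, h⟩ := exists_le_norm_lattice_add N z
  have hy := z.im_pos
  refine ⟨z.im * (2 * N / κ ^ 3), fun ε hε m k hm r ↦ ?_⟩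
  have hx : ![m, k] ≠ 0 := fun h ↦ hm (by simpa using congrFun h 0)
  have hx' := norm_pos_iff.mpr hx
  have h0 := h m k hm 0
  simp only [Fin.val_zero, Nat.cast_zero, add_zero] at h0
  refine (abs_regInv_sub_le hε (latticeForm_pos N z hm _) (latticeForm_pos N z hm _)).trans ?_
  have huv : |‖(m : ℂ) * N * z + ((k * N + r : ℤ) : ℂ)‖ - ‖(m : ℂ) * N * z + ((k * N : ℤ) : ℂ)‖|
      ≤ N := by
    refine (abs_norm_sub_norm_le _ _).trans ?_
    have : (m : ℂ) * N * z + ((k * N + r : ℤ) : ℂ) - ((m : ℂ) * N * z + ((k * N : ℤ) : ℂ))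
        = ((r : ℕ) : ℂ) := by push_cast; ring
    rw [this, Complex.norm_natCast]
    exact_mod_cast r.2.le
  have key := abs_inv_sq_sub_inv_sq_le (by positivity) (h m k hm r) h0 huv
  rw [latticeForm_eq, latticeForm_eq, one_div_div, one_div_div, div_eq_mul_one_div z.im,
    div_eq_mul_one_div z.im, ← mul_sub, abs_mul, abs_of_pos hy]
  calc _ ≤ z.im * (2 * N / (κ * ‖![m, k]‖) ^ 3) := by gcongr
    _ = _ := by
      rw [Real.rpow_neg hx'.le]
      norm_cast
      rw [mul_pow]
      field_simp

lemma summable_vec_norm_rpow {k : ℝ} (hk : 2 < k) :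
    Summable fun p : ℤ × ℤ ↦ ‖![p.1, p.2]‖ ^ (-k) :=
  (finTwoArrowEquiv ℤ).symm.summable_iff.mpr (EisensteinSeries.summable_one_div_norm_rpow hk)

lemma DirichletCharacter.map_zero_of_one_lt {q : ℕ} (χ : DirichletCharacter ℂ q) (hq : 1 < q) :
    χ 0 = 0 := by
  have : Fact (1 < q) := ⟨hq⟩
  exact χ.map_nonunit not_isUnit_zero

lemma summable_regEisenstein {q₁ q₂ : ℕ} [NeZero q₂] (χ₁ : DirichletCharacter ℂ q₁)
    (χ₂ : DirichletCharacter ℂ q₂) {ε : ℝ} (hε : 0 < ε) (z : ℍ) :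
    Summable fun p : ℤ × ℤ ↦ χ₁ p.1 * χ₂ p.2 * (regInv ε (latticeForm q₂ z p) : ℂ) := by
  have hN : (0 : ℝ) < q₂ := by exact_mod_cast NeZero.pos q₂
  have hy := z.im_pos
  -- The form is that of the standard lattice at `q₂ z`, so the usual Eisenstein lower bound applies
  -- there.
  let z' : ℍ := ⟨q₂ * (z : ℂ), by simpa using mul_pos hN hy⟩
  have hz' : (z' : ℂ) = q₂ * (z : ℂ) := rfl
  set ρ := EisensteinSeries.r z' with hρ
  have hρ0 : 0 < ρ := EisensteinSeries.r_pos z'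
  refine Summable.of_norm_bounded
    ((summable_vec_norm_rpow (by norm_num : (2 : ℝ) < 4)).mul_left (z.im ^ 2 / (ε * ρ ^ 4)))
    fun p ↦ ?_
  have hχ : ‖χ₁ p.1 * χ₂ p.2‖ ≤ 1 := by
    rw [norm_mul]
    exact mul_le_one₀ (χ₁.norm_le_one _) (norm_nonneg _) (χ₂.norm_le_one _)
  rw [norm_mul, Complex.norm_real]
  refine (mul_le_of_le_one_left (norm_nonneg _) hχ).trans ?_
  by_cases hp : ![p.1, p.2] = 0
  -- At the origin the term vanishes, since `regInv ε 0 = 1 / 0 = 0`.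
  · have h₁ : p.1 = 0 := by simpa using congrFun hp 0
    have h₂ : p.2 = 0 := by simpa using congrFun hp 1
    simp only [latticeForm, h₁, h₂, regInv]
    simp only [Int.cast_zero, zero_mul, add_zero, map_zero, zero_div, mul_zero, div_zero, norm_zero]
    positivity
  · have hx := norm_pos_iff.mpr hp
    have h := EisensteinSeries.r_mul_max_le z' hp
    rw [← hρ, hz'] at h
    simp only [Matrix.cons_val_zero, Matrix.cons_val_one] at h
    have ht : (ρ * ‖![p.1, p.2]‖) ^ 2 / z.im ≤ latticeForm q₂ z p := by
      rw [← Prod.mk.eta (p := p), latticeForm_eq, mul_assoc]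
      gcongr
    set t := latticeForm q₂ z p
    have ht0 : 0 < (ρ * ‖![p.1, p.2]‖) ^ 2 / z.im := by positivity
    have ht1 : 0 < t := ht0.trans_le ht
    rw [regInv, Real.norm_of_nonneg (by positivity)]
    calc 1 / (t * (1 + ε * t)) ≤ 1 / (ε * t ^ 2) := by
          apply one_div_le_one_div_of_le (by positivity)
          nlinarith
      _ ≤ 1 / (ε * ((ρ * ‖![p.1, p.2]‖) ^ 2 / z.im) ^ 2) := by gcongr
      _ = _ := by
        rw [Real.rpow_neg hx.le]
        norm_cast
        field_simp

/-! ### Block summation and the limit `ε → 0⁺` -/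

/-- The sum of the terms of the regularized Eisenstein series over a block `n ∈ [k q₂, (k + 1) q₂)`
of consecutive integers. -/
noncomputable def regBlock {q₁ q₂ : ℕ} (χ₁ : DirichletCharacter ℂ q₁) (χ₂ : DirichletCharacter ℂ q₂)
    (z : ℍ) (ε : ℝ) (p : ℤ × ℤ) : ℂ :=
  χ₁ p.1 * ∑ r : Fin q₂, χ₂ ((r : ℕ) : ZMod q₂) *
    (regInv ε (latticeForm q₂ z (p.1, p.2 * q₂ + r)) : ℂ)

lemma regEisenstein_eq_tsum_regBlock {q₁ q₂ : ℕ} [NeZero q₂] (χ₁ : DirichletCharacter ℂ q₁)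
    (χ₂ : DirichletCharacter ℂ q₂) {ε : ℝ} (hε : 0 < ε) (z : ℍ) :
    regEisenstein χ₁ χ₂ ε z = ∑' p : ℤ × ℤ, regBlock χ₁ χ₂ z ε p := by
  let e : ℤ × ℤ ≃ (ℤ × ℤ) × Fin q₂ :=
    ((Equiv.refl ℤ).prodCongr (Int.divModEquiv q₂)).trans (Equiv.prodAssoc ℤ ℤ (Fin q₂)).symm
  have hs := e.symm.summable_iff.mpr (summable_regEisenstein χ₁ χ₂ hε z)
  rw [regEisenstein, ← e.symm.tsum_eq]
  refine (hs.tsum_prod' fun p ↦ (hasSum_fintype _).summable).trans (tsum_congr fun p ↦ ?_)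
  rw [tsum_fintype, regBlock, Finset.mul_sum]
  refine Finset.sum_congr rfl fun r _ ↦ ?_
  simp [e, mul_assoc]

/-- As `χ₂` sums to zero over a full period, the value at the left end of the block may be
subtracted from every term. The row `m = 0`, where the difference estimate is unavailable, is killed
by `χ₁ 0 = 0`. -/
lemma exists_norm_regBlock_le {q₁ q₂ : ℕ} [NeZero q₂] (χ₁ : DirichletCharacter ℂ q₁)
    (χ₂ : DirichletCharacter ℂ q₂) (hq₁ : 1 < q₁) (hχ₂ : χ₂ ≠ 1) (z : ℍ) :
    ∃ C : ℝ, ∀ ε ≥ 0, ∀ p : ℤ × ℤ, ‖regBlock χ₁ χ₂ z ε p‖ ≤ C * ‖![p.1, p.2]‖ ^ (-3 : ℝ) := by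
  obtain ⟨C, hC⟩ := exists_abs_regInv_latticeForm_sub_le q₂ z
  have hsum : ∑ r : Fin q₂, χ₂ ((r : ℕ) : ZMod q₂) = 0 := by
    rw [Fin.sum_natCast_zmod (fun x ↦ χ₂ x), MulChar.sum_eq_zero_of_ne_one hχ₂]
  have hC0 : 0 ≤ C := by
    have := (abs_nonneg _).trans (hC 0 le_rfl 1 0 one_ne_zero 0)
    exact nonneg_of_mul_nonneg_left this
      (Real.rpow_pos_of_pos (norm_pos_iff.mpr fun h ↦ by simpa using congrFun h 0) _)
  refine ⟨q₂ * C, fun ε hε p ↦ ?_⟩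
  by_cases hm : p.1 = 0
  · rw [regBlock, hm, Int.cast_zero, χ₁.map_zero_of_one_lt hq₁, zero_mul, norm_zero]
    positivity
  · have h : regBlock χ₁ χ₂ z ε p = χ₁ p.1 * ∑ r : Fin q₂, χ₂ ((r : ℕ) : ZMod q₂) *
        ((regInv ε (latticeForm q₂ z (p.1, p.2 * q₂ + r)) -
          regInv ε (latticeForm q₂ z (p.1, p.2 * q₂)) : ℝ) : ℂ) := by
      simp only [Complex.ofReal_sub, mul_sub, Finset.sum_sub_distrib, ← Finset.sum_mul, hsum,
        zero_mul, sub_zero, regBlock]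
    rw [h, norm_mul]
    refine (mul_le_of_le_one_left (norm_nonneg _) (χ₁.norm_le_one _)).trans ?_
    refine (norm_sum_le _ _).trans ?_
    refine (Finset.sum_le_card_nsmul _ _ (C * ‖![p.1, p.2]‖ ^ (-3 : ℝ)) fun r _ ↦ ?_).trans ?_
    · rw [norm_mul, Complex.norm_real]
      exact (mul_le_of_le_one_left (norm_nonneg _) (χ₂.norm_le_one _)).trans
        (hC ε hε p.1 p.2 hm r)
    · simp [mul_assoc]

lemma summable_regBlock {q₁ q₂ : ℕ} [NeZero q₂] (χ₁ : DirichletCharacter ℂ q₁)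
    (χ₂ : DirichletCharacter ℂ q₂) (hq₁ : 1 < q₁) (hχ₂ : χ₂ ≠ 1) (z : ℍ) {ε : ℝ} (hε : 0 ≤ ε) :
    Summable (regBlock χ₁ χ₂ z ε) := by
  obtain ⟨C, hC⟩ := exists_norm_regBlock_le χ₁ χ₂ hq₁ hχ₂ z
  exact Summable.of_norm_bounded
    ((summable_vec_norm_rpow (by norm_num : (2 : ℝ) < 3)).mul_left C) (hC ε hε)

open Filter Topology in
lemma tendsto_regEisenstein {q₁ q₂ : ℕ} [NeZero q₂] (χ₁ : DirichletCharacter ℂ q₁)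
    (χ₂ : DirichletCharacter ℂ q₂) (hq₁ : 1 < q₁) (hχ₂ : χ₂ ≠ 1) (z : ℍ) :
    Tendsto (fun ε ↦ regEisenstein χ₁ χ₂ ε z) (𝓝[>] 0) (𝓝 (∑' p, regBlock χ₁ χ₂ z 0 p)) := by
  obtain ⟨C, hC⟩ := exists_norm_regBlock_le χ₁ χ₂ hq₁ hχ₂ z
  have h : Tendsto (fun ε ↦ ∑' p, regBlock χ₁ χ₂ z ε p) (𝓝[>] 0)
      (𝓝 (∑' p, regBlock χ₁ χ₂ z 0 p)) := by
    refine tendsto_tsum_of_dominated_convergence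
      ((summable_vec_norm_rpow (by norm_num : (2 : ℝ) < 3)).mul_left C) (fun p ↦ ?_) ?_
    · refine Tendsto.mono_left ?_ nhdsWithin_le_nhds
      refine (tendsto_finsetSum _ fun r _ ↦ Tendsto.const_mul _ ?_).const_mul _
      refine (Complex.continuous_ofReal.tendsto _).comp ?_
      by_cases ht : latticeForm q₂ z (p.1, p.2 * q₂ + r) = 0
      · simp [regInv, ht]
      · refine ContinuousAt.tendsto (ContinuousAt.div (by fun_prop) (by fun_prop) ?_)
        simpa using ht
    · filter_upwards [self_mem_nhdsWithin] with ε hε p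
      exact hC ε (le_of_lt hε) p
  refine h.congr' ?_
  filter_upwards [self_mem_nhdsWithin] with ε hε
  exact (regEisenstein_eq_tsum_regBlock χ₁ χ₂ hε z).symm

lemma tsum_regBlock_zero_smul {q₁ q₂ : ℕ} [NeZero q₂] (χ₁ : DirichletCharacter ℂ q₁)
    (χ₂ : DirichletCharacter ℂ q₂) (hq₁ : 1 < q₁) (hχ₂ : χ₂ ≠ 1) {γ : SL(2, ℤ)}
    (hγ : γ ∈ CongruenceSubgroup.Gamma0 (q₁ * q₂)) (z : ℍ) :
    ∑' p, regBlock χ₁ χ₂ (γ • z) 0 p =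
      newformPsi χ₁ χ₂ (γ 1 1) * ∑' p, regBlock χ₁ χ₂ z 0 p := by
  refine tendsto_nhds_unique (tendsto_regEisenstein χ₁ χ₂ hq₁ hχ₂ (γ • z)) ?_
  simp only [regEisenstein_smul χ₁ χ₂ hγ]
  exact (tendsto_regEisenstein χ₁ χ₂ hq₁ hχ₂ z).const_mul _

/-! ### Fourier expansion of a single row -/

lemma summable_one_div_normSq_add_int (u : ℍ) :
    Summable fun k : ℤ ↦ ((1 / Complex.normSq (u + k) : ℝ) : ℂ) := by
  have h := (EisensteinSeries.linear_right_summable u 1 (le_refl 2)).norm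
  refine (Complex.ofRealCLM.summable h).congr fun k ↦ ?_
  simp [Complex.normSq_eq_norm_sq]

open ComplexConjugate in
-- Partial fractions write `1/|u + k|²` as a multiple of `1/(u + k) - 1/(ū + k)`; the cotangent
-- expansion then applies to `u`, and its complex conjugate handles `ū`.
lemma tsum_one_div_normSq_add_int (u : ℍ) :
    ∑' k : ℤ, ((1 / Complex.normSq (u + k) : ℝ) : ℂ) = Real.pi / u.im *
      (1 + ∑' n : ℕ+, Complex.exp (2 * Real.pi * Complex.I * n * u) +
        ∑' n : ℕ+, conj (Complex.exp (2 * Real.pi * Complex.I * n * u))) := by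
  have hne (k : ℤ) : (u : ℂ) + k ≠ 0 := by
    intro h
    have := congrArg Complex.im h
    simp [u.im_ne_zero] at this
  have hne' (k : ℤ) : conj (u : ℂ) + k ≠ 0 := by
    intro h
    have := congrArg Complex.im h
    simp [u.im_ne_zero] at this
  have hc : (conj (u : ℂ) - u) = -2 * Complex.I * u.im := by
    apply Complex.ext <;> simp
    ring
  have him : (u.im : ℂ) ≠ 0 := by exact_mod_cast u.im_ne_zero
  have hterm (k : ℤ) : ((1 / Complex.normSq (u + k) : ℝ) : ℂ) =
      (-2 * Complex.I * u.im)⁻¹ * (1 / ((u : ℂ) + k) - 1 / (conj (u : ℂ) + k)) := by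
    have h1 := hne k
    have h2 := hne' k
    have h3 : ((Complex.normSq (u + k) : ℝ) : ℂ) = ((u : ℂ) + k) * (conj (u : ℂ) + k) := by
      rw [← Complex.mul_conj]; simp
    rw [← hc, Complex.ofReal_div, h3, div_sub_div _ _ h1 h2, Complex.ofReal_one]
    have h4 : conj (u : ℂ) - u ≠ 0 := by rw [hc]; simp [him]
    field_simp
    ring
  have hu : (u : ℂ) ∈ Complex.integerComplement := by
    rintro ⟨k, hk⟩
    exact hne (-k) (by rw [← hk]; push_cast; ring)
  set S : ℕ+ → ℂ := fun n ↦ 1 / ((u : ℂ) - n) + 1 / ((u : ℂ) + n) with hS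
  have hSsum : Summable S := by
    rw [hS, summable_pnat_iff_summable_succ (f := fun n : ℕ ↦ 1 / ((u : ℂ) - n) + 1 / ((u : ℂ) + n))]
    refine (summable_cotTerm hu).congr fun n ↦ ?_
    simp [cotTerm]
  have hS' : Summable fun n ↦ conj (S n) := (Complex.conjCLE.summable).mpr hSsum
  have hcot := cot_series_rep hu
  have hq := pi_mul_cot_pi_q_exp u
  have hgeom : ∑' n : ℕ, Complex.exp (2 * Real.pi * Complex.I * u) ^ n =
      1 + ∑' n : ℕ+, Complex.exp (2 * Real.pi * Complex.I * n * u) := by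
    have hs : Summable fun n : ℕ ↦ Complex.exp (2 * Real.pi * Complex.I * u) ^ n :=
      summable_geometric_of_norm_lt_one (UpperHalfPlane.norm_exp_two_pi_I_lt_one u)
    rw [← tsum_zero_pnat_eq_tsum_nat hs, pow_zero]
    congr 1
    refine tsum_congr fun n ↦ ?_
    rw [← Complex.exp_nat_mul]
    congr 1
    ring
  rw [hgeom, hcot] at hq
  have hP : 1 / (u : ℂ) + ∑' n, S n = -(Real.pi * Complex.I) * (1 + 2 *
      ∑' n : ℕ+, Complex.exp (2 * Real.pi * Complex.I * n * u)) := by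
    rw [hS, hq]; ring
  have hPc : 1 / conj (u : ℂ) + ∑' n, conj (S n) = Real.pi * Complex.I * (1 + 2 *
      ∑' n : ℕ+, conj (Complex.exp (2 * Real.pi * Complex.I * n * u))) := by
    have := congrArg conj hP
    rw [← Complex.conj_tsum, ← Complex.conj_tsum]
    simpa [map_ofNat] using this
  rw [tsum_int_eq_zero_add_tsum_pnat (summable_one_div_normSq_add_int u), add_assoc]
  have hsum := summable_int_iff_summable_nat_and_neg.mp (summable_one_div_normSq_add_int u)
  rw [← Summable.tsum_add
    (summable_pnat_iff_summable_nat (f := fun n : ℕ ↦ ((1 / Complex.normSq (u + (n : ℤ)) : ℝ) : ℂ))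
      |>.mpr hsum.1)
    (summable_pnat_iff_summable_nat
      (f := fun n : ℕ ↦ ((1 / Complex.normSq (u + (-(n : ℤ) : ℤ)) : ℝ) : ℂ)) |>.mpr hsum.2)]
  -- Pairing `n` with `-n` makes the two partial-fraction series converge separately.
  have hpair (n : ℕ+) : ((1 / Complex.normSq (u + ((n : ℕ) : ℤ)) : ℝ) : ℂ) +
      ((1 / Complex.normSq (u + (-((n : ℕ) : ℤ) : ℤ)) : ℝ) : ℂ) =
        (-2 * Complex.I * u.im)⁻¹ * (S n - conj (S n)) := by
    rw [hterm, hterm, hS]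
    simp only [map_add, map_sub, map_div₀, map_one, Complex.conj_natCast]
    push_cast
    ring
  rw [tsum_congr hpair, tsum_mul_left, hSsum.tsum_sub hS', hterm 0]
  have : (-2 * Complex.I * u.im)⁻¹ * (1 / ((u : ℂ) + (0 : ℤ)) - 1 / (conj (u : ℂ) + (0 : ℤ))) +
      (-2 * Complex.I * u.im)⁻¹ * (∑' n, S n - ∑' n, conj (S n)) =
      (-2 * Complex.I * u.im)⁻¹ * ((1 / (u : ℂ) + ∑' n, S n) -
        (1 / conj (u : ℂ) + ∑' n, conj (S n))) := by
    push_cast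
    ring
  rw [this, hP, hPc]
  generalize ∑' n : ℕ+, Complex.exp (2 * Real.pi * Complex.I * n * u) = Q
  generalize ∑' n : ℕ+, conj (Complex.exp (2 * Real.pi * Complex.I * n * u)) = Q'
  field_simp
  ring

lemma summable_exp_pnat (u : ℍ) :
    Summable fun n : ℕ+ ↦ Complex.exp (2 * Real.pi * Complex.I * n * u) := by
  have hs : Summable fun n : ℕ ↦ Complex.exp (2 * Real.pi * Complex.I * u) ^ n :=
    summable_geometric_of_norm_lt_one (UpperHalfPlane.norm_exp_two_pi_I_lt_one u)
  refine ((summable_pnat_iff_summable_nat (f := fun n : ℕ ↦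
    Complex.exp (2 * Real.pi * Complex.I * u) ^ n)).mpr hs).congr fun n ↦ ?_
  rw [← Complex.exp_nat_mul]
  congr 1
  ring

lemma DirichletCharacter.apply_neg_one_mul_self {N : ℕ} (χ : DirichletCharacter ℂ N) :
    χ (-1) * χ (-1) = 1 := by
  rw [← map_mul, neg_mul_neg, one_mul, map_one]

lemma DirichletCharacter.inv_apply_neg_one {N : ℕ} (χ : DirichletCharacter ℂ N) :
    χ⁻¹ (-1) = χ (-1) := by
  rw [MulChar.inv_apply_eq_inv']
  exact inv_eq_of_mul_eq_one_left χ.apply_neg_one_mul_self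

lemma DirichletCharacter.IsPrimitive.ne_one {N : ℕ} {χ : DirichletCharacter ℂ N}
    (hχ : χ.IsPrimitive) (hN : 1 < N) : χ ≠ 1 := by
  have : NeZero N := ⟨by omega⟩
  rintro rfl
  rw [DirichletCharacter.isPrimitive_def, DirichletCharacter.conductor_one] at hχ
  omega

lemma sum_mul_stdAddChar {N : ℕ} [NeZero N] {χ : DirichletCharacter ℂ N} (hχ : χ.IsPrimitive)
    (n : ℤ) : ∑ r : Fin N, χ ((r : ℕ) : ZMod N) * Complex.exp (2 * Real.pi * Complex.I * (n * r / N))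
      = χ⁻¹ n * gaussSum χ ZMod.stdAddChar := by
  rw [← gaussSum_mulShift_of_isPrimitive _ hχ, gaussSum, ← Fin.sum_natCast_zmod]
  refine Finset.sum_congr rfl fun r _ ↦ ?_
  have : (n : ZMod N) * ((r : ℕ) : ZMod N) = ((n * r : ℤ) : ZMod N) := by push_cast; rfl
  rw [AddChar.mulShift_apply, this, ZMod.stdAddChar_coe]
  push_cast
  congr 2
  ring

open ComplexConjugate in
-- With `u_r = m z + r/N`, each residue class contributes the previous expansion at `u_r`. Summing
-- against `χ` kills the constant term and turns the phases into Gauss sums; the conjugated series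
-- has frequency `-n`, whence the factor `χ(-1)`.
lemma tsum_sum_one_div_latticeForm {N : ℕ} [NeZero N] {χ : DirichletCharacter ℂ N}
    (hN : 1 < N) (hχ : χ.IsPrimitive) (z : ℍ) (m : ℕ+) :
    ∑' k : ℤ, ∑ r : Fin N, χ ((r : ℕ) : ZMod N) *
        (regInv 0 (latticeForm N z ((m : ℕ), k * N + r)) : ℂ) =
      Real.pi * gaussSum χ ZMod.stdAddChar / N ^ 2 / m *
        (∑' n : ℕ+, χ⁻¹ ((n : ℕ) : ZMod N) * Complex.exp (2 * Real.pi * Complex.I * (m * n) * z) +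
          χ (-1) * ∑' n : ℕ+, χ⁻¹ ((n : ℕ) : ZMod N) *
            conj (Complex.exp (2 * Real.pi * Complex.I * (m * n) * z))) := by
  have hN0 : (N : ℝ) ≠ 0 := by exact_mod_cast NeZero.ne N
  have hN0' : (N : ℂ) ≠ 0 := by exact_mod_cast NeZero.ne N
  have hm : (0 : ℝ) < m := by exact_mod_cast m.pos
  have hm' : (m : ℂ) ≠ 0 := by exact_mod_cast m.ne_zero
  have hy := z.im_pos
  have hy' : (z.im : ℂ) ≠ 0 := by exact_mod_cast hy.ne'
  let u (r : Fin N) : ℍ := ⟨m * (z : ℂ) + (r : ℕ) / (N : ℕ), by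
    have : (((r : ℕ) : ℂ) / (N : ℕ)).im = 0 := by
      rw [← Complex.ofReal_natCast, ← Complex.ofReal_natCast, ← Complex.ofReal_div, Complex.ofReal_im]
    simpa [this] using mul_pos hm hy⟩
  have hu (r : Fin N) : (u r : ℂ) = m * (z : ℂ) + (r : ℕ) / (N : ℕ) := rfl
  have hu_im (r : Fin N) : (u r).im = m * z.im := by
    have : (((r : ℕ) : ℂ) / (N : ℕ)).im = 0 := by
      rw [← Complex.ofReal_natCast, ← Complex.ofReal_natCast, ← Complex.ofReal_div, Complex.ofReal_im]
    rw [← UpperHalfPlane.coe_im, hu]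
    simp [this]
  have hterm (k : ℤ) (r : Fin N) : (regInv 0 (latticeForm N z ((m : ℕ), k * N + r)) : ℂ) =
      z.im / N ^ 2 * ((1 / Complex.normSq (u r + k) : ℝ) : ℂ) := by
    have : (((m : ℕ) : ℤ) : ℂ) * N * z + ((k * N + r : ℤ) : ℂ) = N * (u r + k) := by
      rw [hu]
      push_cast
      field_simp
      ring
    rw [regInv_zero_left, latticeForm, this, map_mul, Complex.normSq_natCast]
    push_cast
    rw [one_div_div]
    field_simp
  have hexp (r : Fin N) (n : ℕ+) : Complex.exp (2 * Real.pi * Complex.I * n * u r) =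
      Complex.exp (2 * Real.pi * Complex.I * (m * n) * z) *
        Complex.exp (2 * Real.pi * Complex.I * (((n : ℕ) : ℤ) * r / N)) := by
    rw [← Complex.exp_add, hu]
    congr 1
    push_cast
    ring
  have hexp' (r : Fin N) (n : ℕ+) : conj (Complex.exp (2 * Real.pi * Complex.I * n * u r)) =
      conj (Complex.exp (2 * Real.pi * Complex.I * (m * n) * z)) *
        Complex.exp (2 * Real.pi * Complex.I * (((-((n : ℕ) : ℤ) : ℤ) : ℂ) * r / N)) := by
    rw [hexp, map_mul]
    congr 1
    rw [← Complex.exp_conj]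
    congr 1
    simp only [map_mul, map_div₀, map_ofNat, Complex.conj_ofReal, Complex.conj_I, map_natCast,
      map_intCast]
    push_cast
    ring
  have hsum0 : ∑ r : Fin N, χ ((r : ℕ) : ZMod N) = 0 := by
    rw [Fin.sum_natCast_zmod (fun x ↦ χ x), MulChar.sum_eq_zero_of_ne_one (hχ.ne_one hN)]
  simp only [hterm]
  rw [Summable.tsum_finsetSum fun r _ ↦
    ((summable_one_div_normSq_add_int (u r)).mul_left _).mul_left _]
  simp only [tsum_mul_left, tsum_one_div_normSq_add_int, hu_im]
  have hQ : ∑ r : Fin N, χ ((r : ℕ) : ZMod N) *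
      ∑' n : ℕ+, Complex.exp (2 * Real.pi * Complex.I * n * u r) =
      gaussSum χ ZMod.stdAddChar * ∑' n : ℕ+, χ⁻¹ ((n : ℕ) : ZMod N) *
        Complex.exp (2 * Real.pi * Complex.I * (m * n) * z) := by
    simp only [← tsum_mul_left]
    rw [← Summable.tsum_finsetSum fun r _ ↦ (summable_exp_pnat (u r)).mul_left _]
    refine tsum_congr fun n ↦ ?_
    have := sum_mul_stdAddChar hχ ((n : ℕ) : ℤ)
    rw [Int.cast_natCast (R := ZMod N)] at this
    rw [← mul_assoc, mul_comm (gaussSum _ _), ← this, Finset.sum_mul]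
    refine Finset.sum_congr rfl fun r _ ↦ ?_
    rw [hexp]
    push_cast
    ring
  have hQ' : ∑ r : Fin N, χ ((r : ℕ) : ZMod N) *
      ∑' n : ℕ+, conj (Complex.exp (2 * Real.pi * Complex.I * n * u r)) =
      gaussSum χ ZMod.stdAddChar * (χ (-1) * ∑' n : ℕ+, χ⁻¹ ((n : ℕ) : ZMod N) *
        conj (Complex.exp (2 * Real.pi * Complex.I * (m * n) * z))) := by
    simp only [← tsum_mul_left]
    rw [← Summable.tsum_finsetSum fun r _ ↦
      Summable.mul_left (f := fun n : ℕ+ ↦ conj (Complex.exp (2 * Real.pi * Complex.I * n * u r))) _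
        (Complex.conjCLE.summable.mpr (summable_exp_pnat (u r)))]
    refine tsum_congr fun n ↦ ?_
    have h := sum_mul_stdAddChar hχ (-((n : ℕ) : ℤ))
    have hneg : χ⁻¹ ((-((n : ℕ) : ℤ) : ℤ) : ZMod N) = χ (-1) * χ⁻¹ ((n : ℕ) : ZMod N) := by
      rw [Int.cast_neg, Int.cast_natCast, ← neg_one_mul, map_mul, χ.inv_apply_neg_one]
    rw [hneg] at h
    have : gaussSum χ ZMod.stdAddChar * (χ (-1) * (χ⁻¹ ((n : ℕ) : ZMod N) *
        conj (Complex.exp (2 * Real.pi * Complex.I * (m * n) * z)))) =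
        (χ (-1) * χ⁻¹ ((n : ℕ) : ZMod N) * gaussSum χ ZMod.stdAddChar) *
          conj (Complex.exp (2 * Real.pi * Complex.I * (m * n) * z)) := by ring
    rw [this, ← h, Finset.sum_mul]
    refine Finset.sum_congr rfl fun r _ ↦ ?_
    rw [hexp']
    ring
  have hfin : ∀ (A B : Fin N → ℂ) (c d : ℂ), ∑ r : Fin N, χ ((r : ℕ) : ZMod N) *
      (c * (d * (1 + A r + B r))) = c * d * (∑ r : Fin N, χ ((r : ℕ) : ZMod N) +
        ∑ r : Fin N, χ ((r : ℕ) : ZMod N) * A r + ∑ r : Fin N, χ ((r : ℕ) : ZMod N) * B r) := by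
    intro A B c d
    rw [← Finset.sum_add_distrib, ← Finset.sum_add_distrib, Finset.mul_sum]
    exact Finset.sum_congr rfl fun r _ ↦ by ring
  rw [hfin, hsum0, hQ, hQ']
  generalize ∑' n : ℕ+, χ⁻¹ ((n : ℕ) : ZMod N) *
    Complex.exp (2 * Real.pi * Complex.I * (m * n) * z) = Q
  generalize ∑' n : ℕ+, χ⁻¹ ((n : ℕ) : ZMod N) *
    conj (Complex.exp (2 * Real.pi * Complex.I * (m * n) * z)) = Q'
  push_cast
  field_simp
  ring

/-! ### The double series for `f`: convergence, holomorphy, periodicity -/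

lemma newformLambda_one_div_sqrt {q₁ q₂ : ℕ} (χ₁ : DirichletCharacter ℂ q₁)
    (χ₂ : DirichletCharacter ℂ q₂) (n : ℕ+) :
    newformLambda χ₁ χ₂ n 1 / (Real.sqrt (n : ℝ) : ℂ) =
      ∑ p ∈ (n : ℕ).divisorsAntidiagonal,
        χ₁ (p.1 : ZMod q₁) / p.1 * χ₂⁻¹ (p.2 : ZMod q₂) := by
  rw [newformLambda, Finset.sum_div]
  refine Finset.sum_congr rfl fun p hp ↦ ?_
  obtain ⟨hp, hn⟩ := Nat.mem_divisorsAntidiagonal.mp hp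
  have ha : 0 < p.1 := Nat.pos_of_ne_zero fun h ↦ hn (by rw [← hp, h, zero_mul])
  have hb : 0 < p.2 := Nat.pos_of_ne_zero fun h ↦ hn (by rw [← hp, h, mul_zero])
  have ha' : (0 : ℝ) < p.1 := by exact_mod_cast ha
  have hb' : (0 : ℝ) < p.2 := by exact_mod_cast hb
  have h : ((p.2 : ℂ) / (p.1 : ℂ)) ^ ((1 : ℂ) - 1 / 2) = ((Real.sqrt (p.2 / p.1) : ℝ) : ℂ) := by
    rw [Real.sqrt_eq_rpow, Complex.ofReal_cpow (by positivity)]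
    push_cast
    norm_num
  -- For `n = ab`, `√(b/a) / √(ab) = 1/a`.
  have hs : Real.sqrt (p.2 / p.1) / Real.sqrt (n : ℝ) = 1 / p.1 := by
    rw [← Real.sqrt_div (by positivity), ← hp]
    rw [show (p.2 / p.1 / ((p.1 * p.2 : ℕ) : ℝ) : ℝ) = (1 / p.1) ^ 2 by push_cast; field_simp]
    exact Real.sqrt_sq (by positivity)
  rw [h, mul_div_assoc, ← Complex.ofReal_div, hs]
  push_cast
  ring

/-- The terms of the double series for `newformF`. -/
noncomputable def newformTerm {q₁ q₂ : ℕ} (χ₁ : DirichletCharacter ℂ q₁)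
    (χ₂ : DirichletCharacter ℂ q₂) (z : ℂ) (p : ℕ+ × ℕ+) : ℂ :=
  χ₁ ((p.1 : ℕ) : ZMod q₁) / p.1 * χ₂⁻¹ ((p.2 : ℕ) : ZMod q₂) *
    Complex.exp (2 * Real.pi * Complex.I * (p.1 * p.2) * z)

lemma norm_newformTerm_le {q₁ q₂ : ℕ} (χ₁ : DirichletCharacter ℂ q₁)
    (χ₂ : DirichletCharacter ℂ q₂) {z : ℂ} {y : ℝ} (hz : y ≤ z.im) (p : ℕ+ × ℕ+) :
    ‖newformTerm χ₁ χ₂ z p‖ ≤ Real.exp (-2 * Real.pi * y) ^ (p.1 * p.2 : ℕ) := by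
  have h1 : ‖χ₁ ((p.1 : ℕ) : ZMod q₁) / p.1‖ ≤ 1 := by
    rw [norm_div, Complex.norm_natCast]
    refine div_le_one_of_le₀ ((χ₁.norm_le_one _).trans ?_) (by positivity)
    exact_mod_cast (one_le : 1 ≤ p.1)
  rw [newformTerm, norm_mul, norm_mul]
  refine (mul_le_of_le_one_left (norm_nonneg _)
    (mul_le_one₀ h1 (norm_nonneg _) (χ₂⁻¹.norm_le_one _))).trans ?_
  rw [Complex.norm_exp, ← Real.exp_nat_mul]
  apply Real.exp_le_exp.mpr
  have : (2 * Real.pi * Complex.I * (p.1 * p.2) * z).re = (p.1 * p.2 : ℕ) * (-2 * Real.pi * z.im) := by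
    rw [show (2 * Real.pi * Complex.I * (p.1 * p.2) * z : ℂ) =
      ((2 * Real.pi * (p.1 * p.2) : ℝ) : ℂ) * (Complex.I * z) by push_cast; ring,
      Complex.re_ofReal_mul]
    simp
    ring
  rw [this]
  have := Real.pi_pos
  refine mul_le_mul_of_nonneg_left ?_ (by positivity)
  nlinarith

lemma summable_exp_pow_mul {y : ℝ} (hy : 0 < y) :
    Summable fun p : ℕ+ × ℕ+ ↦ Real.exp (-2 * Real.pi * y) ^ (p.1 * p.2 : ℕ) := by
  have hr : ‖Real.exp (-2 * Real.pi * y)‖ < 1 := by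
    rw [Real.norm_of_nonneg (Real.exp_pos _).le, Real.exp_lt_one_iff]
    nlinarith [mul_pos Real.pi_pos hy]
  simpa using summable_prod_mul_pow 0 hr

lemma summable_newformTerm {q₁ q₂ : ℕ} (χ₁ : DirichletCharacter ℂ q₁)
    (χ₂ : DirichletCharacter ℂ q₂) {z : ℂ} (hz : 0 < z.im) :
    Summable (newformTerm χ₁ χ₂ z) :=
  Summable.of_norm_bounded (summable_exp_pow_mul hz) (norm_newformTerm_le χ₁ χ₂ le_rfl)

lemma newformF_eq_tsum {q₁ q₂ : ℕ} (χ₁ : DirichletCharacter ℂ q₁)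
    (χ₂ : DirichletCharacter ℂ q₂) (z : ℍ) :
    newformF χ₁ χ₂ z = ∑' p, newformTerm χ₁ χ₂ z p := by
  have hs := sigmaAntidiagonalEquivProd.summable_iff.mpr (summable_newformTerm χ₁ χ₂ z.im_pos)
  rw [← sigmaAntidiagonalEquivProd.tsum_eq]
  refine Eq.trans (tsum_congr fun n ↦ ?_)
    (hs.tsum_sigma' fun n ↦ (hasSum_fintype _).summable).symm
  rw [newformLambda_one_div_sqrt, tsum_fintype, Finset.sum_mul, ← Finset.sum_coe_sort]
  refine Finset.sum_congr rfl fun p _ ↦ ?_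
  have h : (p.1.1 : ℂ) * p.1.2 = n := by
    exact_mod_cast (Nat.mem_divisorsAntidiagonal.mp p.2).1
  simp only [Function.comp_apply, newformTerm, sigmaAntidiagonalEquivProd, Equiv.coe_fn_mk,
    divisorsAntidiagonalFactors, PNat.mk_coe, h]

lemma differentiableOn_tsum_newformTerm {q₁ q₂ : ℕ} (χ₁ : DirichletCharacter ℂ q₁)
    (χ₂ : DirichletCharacter ℂ q₂) :
    DifferentiableOn ℂ (fun z ↦ ∑' p, newformTerm χ₁ χ₂ z p) {z | 0 < z.im} := by
  intro z hz
  have hz' : 0 < z.im / 2 := half_pos hz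
  have hopen : IsOpen {w : ℂ | z.im / 2 < w.im} := isOpen_lt continuous_const Complex.continuous_im
  -- The majorant is uniform only on half-planes away from the real axis, hence `Im w > Im z / 2`.
  have h := Complex.differentiableOn_tsum_of_summable_norm (F := fun p w ↦ newformTerm χ₁ χ₂ w p)
    (summable_exp_pow_mul hz')
    (fun p ↦ by unfold newformTerm; fun_prop) hopen
    (fun p w hw ↦ norm_newformTerm_le χ₁ χ₂ (le_of_lt hw) p)
  exact (h.differentiableAt (hopen.mem_nhds (half_lt_self (a := z.im) hz))).differentiableWithinAt

lemma newformF_vadd {q₁ q₂ : ℕ} (χ₁ : DirichletCharacter ℂ q₁)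
    (χ₂ : DirichletCharacter ℂ q₂) (k : ℤ) (z : ℍ) :
    newformF χ₁ χ₂ (ModularGroup.T ^ k • z) = newformF χ₁ χ₂ z := by
  refine tsum_congr fun n ↦ ?_
  rw [UpperHalfPlane.modular_T_zpow_smul, UpperHalfPlane.coe_vadd]
  congr 1
  refine Complex.exp_eq_exp_iff_exists_int.mpr ⟨n * k, ?_⟩
  push_cast
  ring

open ComplexConjugate in
lemma newformTerm_neg_conj {q₁ q₂ : ℕ} (χ₁ : DirichletCharacter ℂ q₁)
    (χ₂ : DirichletCharacter ℂ q₂) (z : ℂ) (p : ℕ+ × ℕ+) :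
    newformTerm χ₁ χ₂ (-conj z) p = χ₁ ((p.1 : ℕ) : ZMod q₁) / p.1 *
      χ₂⁻¹ ((p.2 : ℕ) : ZMod q₂) *
        conj (Complex.exp (2 * Real.pi * Complex.I * (p.1 * p.2) * z)) := by
  rw [newformTerm, ← Complex.exp_conj]
  congr 2
  simp only [map_mul, map_ofNat, Complex.conj_ofReal, Complex.conj_I, map_natCast]
  ring

/-! ### Kronecker's limit formula and its invariance -/

lemma latticeForm_neg (N : ℕ) (z : ℍ) (m n : ℤ) :
    latticeForm N z (-m, -n) = latticeForm N z (m, n) := by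
  rw [latticeForm_eq, latticeForm_eq, ← norm_neg]
  congr 3
  push_cast
  ring

/-- A single row converges absolutely even at `ε = 0`, so its blocks can be dissolved. This is
needed for the symmetry `n ↦ -n`, which does not preserve the blocks. -/
lemma tsum_regBlock_zero_row {q₁ q₂ : ℕ} [NeZero q₂] (χ₁ : DirichletCharacter ℂ q₁)
    (χ₂ : DirichletCharacter ℂ q₂) (z : ℍ) (m : ℤ) :
    ∑' k : ℤ, regBlock χ₁ χ₂ z 0 (m, k) =
      χ₁ m * ∑' n : ℤ, χ₂ n * (regInv 0 (latticeForm q₂ z (m, n)) : ℂ) := by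
  have hs : Summable fun n : ℤ ↦ χ₂ n * (regInv 0 (latticeForm q₂ z (m, n)) : ℂ) := by
    have h := (EisensteinSeries.linear_right_summable (q₂ * (z : ℂ)) m (le_refl 2)).norm
    refine Summable.of_norm_bounded (h.mul_left z.im) fun n ↦ ?_
    rw [norm_mul]
    refine (mul_le_of_le_one_left (norm_nonneg _) (χ₂.norm_le_one _)).trans_eq ?_
    rw [Complex.norm_real, regInv_zero_left, latticeForm_eq, one_div_div,
      Real.norm_of_nonneg (div_nonneg z.im_pos.le (by positivity)), norm_inv, norm_zpow, mul_assoc]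
    rfl
  have hs' := (Int.divModEquiv q₂).symm.summable_iff.mpr hs
  simp only [regBlock]
  rw [tsum_mul_left, ← (Int.divModEquiv q₂).symm.tsum_eq
    (fun n : ℤ ↦ χ₂ n * (regInv 0 (latticeForm q₂ z (m, n)) : ℂ))]
  congr 1
  refine (Eq.trans (hs'.tsum_prod' fun p ↦ (hasSum_fintype _).summable)
    (tsum_congr fun k ↦ ?_)).symm
  rw [tsum_fintype]
  refine Finset.sum_congr rfl fun r _ ↦ ?_
  simp

lemma tsum_regBlock_zero_row_neg {q₁ q₂ : ℕ} [NeZero q₂] (χ₁ : DirichletCharacter ℂ q₁)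
    (χ₂ : DirichletCharacter ℂ q₂) (hpar : χ₁ (-1) * χ₂ (-1) = 1) (z : ℍ) (m : ℤ) :
    ∑' k : ℤ, regBlock χ₁ χ₂ z 0 (-m, k) = ∑' k : ℤ, regBlock χ₁ χ₂ z 0 (m, k) := by
  rw [tsum_regBlock_zero_row, tsum_regBlock_zero_row, ← (Equiv.neg ℤ).tsum_eq, ← tsum_mul_left, ← tsum_mul_left]
  refine tsum_congr fun n ↦ ?_
  rw [Equiv.neg_apply, latticeForm_neg, Int.cast_neg, Int.cast_neg, ← neg_one_mul,
    ← neg_one_mul (n : ZMod q₂), map_mul, map_mul]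
  linear_combination χ₁ m * χ₂ n * (regInv 0 (latticeForm q₂ z (m, n)) : ℂ) * hpar

/-- Kronecker's limit formula: the value of the regularized Eisenstein series at the edge of
convergence is the harmonic function `f(z) + χ₂(-1) f(-z̄)`. -/
lemma tsum_regBlock_zero {q₁ q₂ : ℕ} [NeZero q₂] (χ₁ : DirichletCharacter ℂ q₁)
    (χ₂ : DirichletCharacter ℂ q₂) (hq₁ : 1 < q₁) (hq₂ : 1 < q₂) (hχ₂ : χ₂.IsPrimitive)
    (hpar : χ₁ (-1) * χ₂ (-1) = 1) (z : ℍ) :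
    ∑' p, regBlock χ₁ χ₂ z 0 p = 2 * Real.pi * gaussSum χ₂ ZMod.stdAddChar / q₂ ^ 2 *
      (newformF χ₁ χ₂ z + χ₂ (-1) * newformF χ₁ χ₂ (UpperHalfPlane.J • z)) := by
  have hs := summable_regBlock χ₁ χ₂ hq₁ (hχ₂.ne_one hq₂) z le_rfl
  have hev : Function.Even fun m : ℤ ↦ ∑' k : ℤ, regBlock χ₁ χ₂ z 0 (m, k) :=
    tsum_regBlock_zero_row_neg χ₁ χ₂ hpar z
  have h0 : ∑' k : ℤ, regBlock χ₁ χ₂ z 0 (0, k) = 0 := by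
    simp [regBlock, χ₁.map_zero_of_one_lt hq₁]
  have hf := summable_newformTerm χ₁ χ₂ z.im_pos
  have hf' := summable_newformTerm χ₁ χ₂ (UpperHalfPlane.J • z).im_pos
  -- Row `0` vanishes and rows `m`, `-m` agree, which produces the factor `2`.
  rw [hs.tsum_prod, tsum_int_eq_zero_add_two_mul_tsum_pnat hev hs.prod, h0, zero_add,
    newformF_eq_tsum, newformF_eq_tsum, hf.tsum_prod, hf'.tsum_prod, ← tsum_mul_left (a := χ₂ (-1)),
    ← hf.prod.tsum_add (hf'.prod.mul_left _), ← tsum_mul_left, nsmul_eq_mul, ← tsum_mul_left]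
  refine tsum_congr fun m ↦ ?_
  have hrow : ∑' k : ℤ, regBlock χ₁ χ₂ z 0 (((m : ℕ) : ℤ), k) = χ₁ ((m : ℕ) : ZMod q₁) *
      ∑' k : ℤ, ∑ r : Fin q₂, χ₂ ((r : ℕ) : ZMod q₂) *
        (regInv 0 (latticeForm q₂ z ((m : ℕ), k * q₂ + r)) : ℂ) := by
    simp only [regBlock, tsum_mul_left, Int.cast_natCast]
  rw [hrow, tsum_sum_one_div_latticeForm hq₂ hχ₂]
  simp only [UpperHalfPlane.coe_J_smul, newformTerm_neg_conj]
  simp only [newformTerm, mul_assoc, tsum_mul_left]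
  push_cast
  ring

/-- The discrete Fourier transform of a primitive `χ` is a multiple of its Gauss sum, and the
transform is injective while `χ 1 = 1`. -/
lemma DirichletCharacter.IsPrimitive.gaussSum_stdAddChar_ne_zero {N : ℕ} [NeZero N]
    {χ : DirichletCharacter ℂ N} (hχ : χ.IsPrimitive) : gaussSum χ ZMod.stdAddChar ≠ 0 := by
  intro h
  have h0 : ZMod.dft (χ : ZMod N → ℂ) = 0 := by
    funext k
    rw [hχ.fourierTransform_eq_inv_mul_gaussSum, h, mul_zero, Pi.zero_apply]
  have := congrFun ((LinearEquiv.map_eq_zero_iff _).mp h0) 1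
  simp at this

lemma newformF_add_reflection_smul {q₁ q₂ : ℕ} [NeZero q₂] (χ₁ : DirichletCharacter ℂ q₁)
    (χ₂ : DirichletCharacter ℂ q₂) (hq₁ : 1 < q₁) (hq₂ : 1 < q₂) (hχ₂ : χ₂.IsPrimitive)
    (hpar : χ₁ (-1) * χ₂ (-1) = 1) {γ : SL(2, ℤ)}
    (hγ : γ ∈ CongruenceSubgroup.Gamma0 (q₁ * q₂)) (z : ℍ) :
    newformF χ₁ χ₂ (γ • z) + χ₂ (-1) * newformF χ₁ χ₂ (UpperHalfPlane.J • γ • z) =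
      newformPsi χ₁ χ₂ (γ 1 1) *
        (newformF χ₁ χ₂ z + χ₂ (-1) * newformF χ₁ χ₂ (UpperHalfPlane.J • z)) := by
  have h := tsum_regBlock_zero_smul χ₁ χ₂ hq₁ (hχ₂.ne_one hq₂) hγ z
  rw [tsum_regBlock_zero χ₁ χ₂ hq₁ hq₂ hχ₂ hpar, tsum_regBlock_zero χ₁ χ₂ hq₁ hq₂ hχ₂ hpar,
    mul_left_comm] at h
  refine mul_left_cancel₀ (div_ne_zero (mul_ne_zero (mul_ne_zero two_ne_zero ?_)
    hχ₂.gaussSum_stdAddChar_ne_zero) ?_) h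
  · exact_mod_cast Real.pi_ne_zero
  · exact pow_ne_zero _ (by exact_mod_cast NeZero.ne q₂)

/-! ### Reflection and constancy of the cocycle -/

/-- The conjugate `(a, -b; -c, d)` of `(a, b; c, d)` by the reflection `z ↦ -z̄`. -/
def SL2Z_reflect (γ : SL(2, ℤ)) : SL(2, ℤ) :=
  ⟨!![γ 0 0, -γ 0 1; -γ 1 0, γ 1 1], by
    rw [Matrix.det_fin_two_of, neg_mul_neg, SL2Z_det_eq]⟩

lemma J_smul_SL2Z_smul (γ : SL(2, ℤ)) (z : ℍ) :
    UpperHalfPlane.J • γ • z = SL2Z_reflect γ • UpperHalfPlane.J • z := by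
  apply UpperHalfPlane.ext
  rw [UpperHalfPlane.coe_J_smul, SL2Z_coe_smul, SL2Z_coe_smul, UpperHalfPlane.coe_J_smul]
  simp only [SL2Z_reflect, map_div₀, map_add, map_mul, map_intCast, Matrix.of_apply,
    Matrix.cons_val', Matrix.cons_val_zero, Matrix.cons_val_one, Matrix.cons_val_fin_one]
  rw [← neg_div]
  push_cast
  congr 1 <;> ring

lemma J_smul_J_smul (z : ℍ) : UpperHalfPlane.J • UpperHalfPlane.J • z = z := by
  apply UpperHalfPlane.ext
  simp [UpperHalfPlane.coe_J_smul]

open ComplexConjugate in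
/-- A function on the upper half-plane which is both holomorphic and the reflection of a
holomorphic function is constant. -/
lemma exists_eq_const_of_eq_comp_neg_conj {f g : ℂ → ℂ} (hf : DifferentiableOn ℂ f {z | 0 < z.im})
    (hg : DifferentiableOn ℂ g {z | 0 < z.im}) (h : ∀ z : ℂ, 0 < z.im → f z = g (-conj z)) :
    ∃ s, ∀ z : ℂ, 0 < z.im → f z = s := by
  have hopen : IsOpen {z : ℂ | 0 < z.im} := isOpen_lt continuous_const Complex.continuous_im
  have hconn : IsPreconnected {z : ℂ | 0 < z.im} := (convex_halfSpace_im_gt 0).isPreconnected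
  have hderiv : Set.EqOn (deriv f) 0 {z | 0 < z.im} := by
    intro z hz
    have hz' : 0 < (-conj z).im := by simpa using hz
    have hfz := (hf.differentiableAt (hopen.mem_nhds hz)).hasDerivAt
    have hgz := (hg.differentiableAt (hopen.mem_nhds hz')).hasDerivAt
    -- Differentiate along the real line through `z` in direction `v`. The choices `v = 1` and `v =
    -- i` give `f' = -g'` and `f' = g'`, so `f' = 0`.
    have key (v : ℂ) : v * deriv f z = -conj v * deriv g (-conj z) := by
      have hl : HasDerivAt (fun t : ℝ ↦ z + t * v) v 0 := by
        simpa using ((Complex.ofRealCLM.hasDerivAt (x := 0)).mul_const v).const_add z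
      have hl' : HasDerivAt (fun t : ℝ ↦ -conj z + t * -conj v) (-conj v) 0 := by
        simpa using ((Complex.ofRealCLM.hasDerivAt (x := 0)).mul_const (-conj v)).const_add (-conj z)
      have h1 := hfz.scomp_of_eq (0 : ℝ) hl (by simp)
      have h2 := hgz.scomp_of_eq (0 : ℝ) hl' (by simp)
      refine h1.unique (h2.congr_of_eventuallyEq ?_)
      have hev : ∀ᶠ t : ℝ in nhds 0, 0 < (z + t * v).im :=
        (continuous_const.tendsto (0 : ℝ)).eventually_lt
          (Continuous.tendsto (f := fun t : ℝ ↦ (z + t * v).im) (by fun_prop) 0) (by simpa using hz)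
      filter_upwards [hev] with t ht
      simp only [Function.comp_apply]
      rw [h _ ht]
      congr 1
      simp
      ring
    have h1 := key 1
    have h2 := key Complex.I
    simp only [map_one, Complex.conj_I, neg_neg] at h1 h2
    have h3 := mul_left_cancel₀ Complex.I_ne_zero h2
    rw [← h3] at h1
    rw [Pi.zero_apply]
    linear_combination h1 / 2
  obtain ⟨s, hs⟩ := hopen.exists_is_const_of_deriv_eq_zero hconn hf hderiv
  exact ⟨s, fun z hz ↦ hs z hz⟩

lemma exists_differentiableOn_newformF_smul_sub {q₁ q₂ : ℕ} (χ₁ : DirichletCharacter ℂ q₁)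
    (χ₂ : DirichletCharacter ℂ q₂) (γ : SL(2, ℤ)) (ψ : ℂ) :
    ∃ f : ℂ → ℂ, DifferentiableOn ℂ f {z | 0 < z.im} ∧
      ∀ z : ℍ, f z = newformF χ₁ χ₂ (γ • z) - ψ * newformF χ₁ χ₂ z := by
  have hF := differentiableOn_tsum_newformTerm χ₁ χ₂
  refine ⟨fun w ↦ (∑' p, newformTerm χ₁ χ₂ (((γ 0 0 : ℤ) * w + (γ 0 1 : ℤ)) /
    ((γ 1 0 : ℤ) * w + (γ 1 1 : ℤ))) p) - ψ * ∑' p, newformTerm χ₁ χ₂ w p, ?_, fun z ↦ ?_⟩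
  · refine (hF.comp (DifferentiableOn.div (by fun_prop) (by fun_prop) fun w hw ↦ ?_) ?_).sub
      (hF.const_mul ψ)
    · exact SL2Z_denom_ne_zero γ ⟨w, hw⟩
    · intro w hw
      have := (γ • (⟨w, hw⟩ : ℍ)).im_pos
      rwa [← UpperHalfPlane.coe_im, SL2Z_coe_smul] at this
  · rw [newformF_eq_tsum, newformF_eq_tsum, SL2Z_coe_smul]

lemma exists_newformF_cocycle {q₁ q₂ : ℕ} [NeZero q₂] (χ₁ : DirichletCharacter ℂ q₁)
    (χ₂ : DirichletCharacter ℂ q₂) (hq₁ : 1 < q₁) (hq₂ : 1 < q₂) (hχ₂ : χ₂.IsPrimitive)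
    (hpar : χ₁ (-1) * χ₂ (-1) = 1) {γ : SL(2, ℤ)}
    (hγ : γ ∈ CongruenceSubgroup.Gamma0 (q₁ * q₂)) :
    ∃ s : ℂ, (∀ z, newformF χ₁ χ₂ (γ • z) = s + newformPsi χ₁ χ₂ (γ 1 1) * newformF χ₁ χ₂ z) ∧
      ∀ z, newformF χ₁ χ₂ (SL2Z_reflect γ • z) =
        -χ₂ (-1) * s + newformPsi χ₁ χ₂ (γ 1 1) * newformF χ₁ χ₂ z := by
  set ψ := newformPsi χ₁ χ₂ (γ 1 1)
  obtain ⟨f, hf, hf'⟩ := exists_differentiableOn_newformF_smul_sub χ₁ χ₂ γ ψ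
  obtain ⟨g, hg, hg'⟩ := exists_differentiableOn_newformF_smul_sub χ₁ χ₂ (SL2Z_reflect γ) ψ
  have hrel (z : ℍ) : newformF χ₁ χ₂ (γ • z) - ψ * newformF χ₁ χ₂ z = -χ₂ (-1) *
      (newformF χ₁ χ₂ (SL2Z_reflect γ • UpperHalfPlane.J • z) -
        ψ * newformF χ₁ χ₂ (UpperHalfPlane.J • z)) := by
    have := newformF_add_reflection_smul χ₁ χ₂ hq₁ hq₂ hχ₂ hpar hγ z
    rw [J_smul_SL2Z_smul] at this
    linear_combination this
  obtain ⟨s, hs⟩ := exists_eq_const_of_eq_comp_neg_conj hf (hg.const_mul (-χ₂ (-1)))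
    fun z hz ↦ by
      have h1 := hf' ⟨z, hz⟩
      have h2 := hg' (UpperHalfPlane.J • ⟨z, hz⟩)
      rw [UpperHalfPlane.coe_J_smul] at h2
      exact h1.trans ((hrel ⟨z, hz⟩).trans (congrArg (-χ₂ (-1) * ·) h2.symm))
  have hs' (z : ℍ) : newformF χ₁ χ₂ (γ • z) - ψ * newformF χ₁ χ₂ z = s := by
    rw [← hf', hs _ z.im_pos]
  refine ⟨s, fun z ↦ by linear_combination hs' z, fun z ↦ ?_⟩
  -- Evaluating at `Jz` and using `J² = 1` solves for the reflected matrix.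
  have h := hrel (UpperHalfPlane.J • z)
  rw [hs', J_smul_J_smul] at h
  linear_combination χ₂ (-1) * h - (newformF χ₁ χ₂ (SL2Z_reflect γ • z) -
    ψ * newformF χ₁ χ₂ z) * χ₂.apply_neg_one_mul_self

/-! ### Comparison with the inverse and vanishing -/

/-- If `γ⁻¹` agrees with `δ` up to translations on both sides, then the cocycle values of `γ` and
`δ` are related. -/
lemma newformF_cocycle_relation {q₁ q₂ : ℕ} (χ₁ : DirichletCharacter ℂ q₁)
    (χ₂ : DirichletCharacter ℂ q₂) {γ δ : SL(2, ℤ)} {s s' ψ : ℂ} (hψ : ψ * ψ = 1)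
    (hγ : ∀ z, newformF χ₁ χ₂ (γ • z) = s + ψ * newformF χ₁ χ₂ z)
    (hδ : ∀ z, newformF χ₁ χ₂ (δ • z) = s' + ψ * newformF χ₁ χ₂ z) (k : ℤ)
    (h : (δ⁻¹ * (ModularGroup.T ^ k * γ⁻¹)) 1 0 = 0) : s = -ψ * s' := by
  -- An upper triangular element acts as a translation, its sign being invisible on the half-plane;
  -- so `T^k γ⁻¹` acts as `δ T^j`.
  obtain ⟨j, hj⟩ := ModularGroup.exists_eq_T_zpow_of_c_eq_zero h
  have h₁ := hγ (γ⁻¹ • UpperHalfPlane.I)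
  rw [smul_inv_smul] at h₁
  have h₂ := hδ (ModularGroup.T ^ j • UpperHalfPlane.I)
  rw [← hj, ← mul_smul, mul_inv_cancel_left, mul_smul, newformF_vadd, hj, newformF_vadd] at h₂
  linear_combination -h₁ - ψ * h₂ - newformF χ₁ χ₂ UpperHalfPlane.I * hψ

lemma newformPsi_mul_of_mem_Gamma0 {q₁ q₂ : ℕ} (χ₁ : DirichletCharacter ℂ q₁)
    (χ₂ : DirichletCharacter ℂ q₂) {γ : SL(2, ℤ)}
    (hγ : γ ∈ CongruenceSubgroup.Gamma0 (q₁ * q₂)) :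
    newformPsi χ₁ χ₂ (γ 0 0) * newformPsi χ₁ χ₂ (γ 1 1) = 1 := by
  rw [CongruenceSubgroup.Gamma0_mem, ZMod.intCast_zmod_eq_zero_iff_dvd] at hγ
  obtain ⟨c, hc⟩ := hγ
  have h := SL2Z_det_eq γ
  rw [hc] at h
  have h₁ := congrArg (Int.cast : ℤ → ZMod q₁) h
  have h₂ := congrArg (Int.cast : ℤ → ZMod q₂) h
  push_cast at h₁ h₂
  simp only [CharP.cast_eq_zero, zero_mul, mul_zero, sub_zero] at h₁ h₂
  have hχ₁ := χ₁.apply_mul_apply_of_mul_eq_one h₁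
  have hχ₂ := (χ₂⁻¹).apply_mul_apply_of_mul_eq_one h₂
  unfold newformPsi
  linear_combination hχ₁ * (χ₂⁻¹ ((γ 0 0 : ℤ) : ZMod q₂) * χ₂⁻¹ ((γ 1 1 : ℤ) : ZMod q₂)) + hχ₂

lemma IsNewformDedekindSum.zero_of_cocycle {q₁ q₂ : ℕ} [NeZero q₁] {χ₁ : DirichletCharacter ℂ q₁}
    {χ₂ : DirichletCharacter ℂ q₂} {γ : SL(2, ℤ)}
    (h : ∀ z, newformF χ₁ χ₂ (γ • z) = 0 + newformPsi χ₁ χ₂ (γ 1 1) * newformF χ₁ χ₂ z) :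
    IsNewformDedekindSum χ₁ χ₂ γ 0 := by
  intro z
  rw [h, mul_zero, zero_add, sub_self]

theorem proposition2p2 {q₁ q₂ : ℕ} [NeZero q₁] [NeZero q₂] (hq₁ : 1 < q₁) (hq₂ : 1 < q₂)
    (χ₁ : DirichletCharacter ℂ q₁) (χ₂ : DirichletCharacter ℂ q₂)
    (hχ₁ : χ₁.IsPrimitive) (hχ₂ : χ₂.IsPrimitive) (hpar : χ₁ (-1) * χ₂ (-1) = 1)
    (a c : ℤ) (γ : SL(2, ℤ)) (hγ : γ ∈ CongruenceSubgroup.Gamma0 (q₁ * q₂))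
    (ha : γ 0 0 = a) (hc : γ 1 0 = c) :
    (a ^ 2 ≡ -1 [ZMOD c] → newformPsi χ₁ χ₂ a = 1 → IsNewformDedekindSum χ₁ χ₂ γ 0) ∧
      (a ^ 2 ≡ 1 [ZMOD c] → newformPsi χ₁ χ₂ a = -χ₂ (-1) →
        IsNewformDedekindSum χ₁ χ₂ γ 0) := by
  subst ha hc
  obtain ⟨s, hs, hs'⟩ := exists_newformF_cocycle χ₁ χ₂ hq₁ hq₂ hχ₂ hpar hγ
  have hψ := newformPsi_mul_of_mem_Gamma0 χ₁ χ₂ hγ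
  have hdet := SL2Z_det_eq γ
  have hcop : IsCoprime (γ 1 0) (γ 0 0) := ⟨-γ 0 1, γ 1 1, by linear_combination hdet⟩
  have hε := χ₂.apply_neg_one_mul_self
  constructor
  · intro hmod h1
    rw [h1, one_mul] at hψ
    -- `a(a + d) = (a² + 1) + bc` is divisible by `c`, and `a` is prime to `c`.
    obtain ⟨k, hk⟩ : γ 1 0 ∣ γ 0 0 + γ 1 1 := by
      obtain ⟨e, he⟩ := hmod.symm.dvd
      refine hcop.dvd_of_dvd_mul_left ⟨e + γ 0 1, ?_⟩
      linear_combination he + hdet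
    -- Here `δ = γ`: the lower left entry is `-c(a + d - kc) = 0`, and the relation reads `s = -s`.
    have h := newformF_cocycle_relation χ₁ χ₂ (by rw [hψ, one_mul]) hs hs k (by
      simp only [Matrix.SpecialLinearGroup.coe_mul, ModularGroup.coe_T_zpow,
        Matrix.SpecialLinearGroup.coe_inv, Matrix.adjugate_fin_two, Matrix.mul_apply,
        Fin.sum_univ_two, Matrix.of_apply, Matrix.cons_val', Matrix.cons_val_zero,
        Matrix.cons_val_one, Matrix.cons_val_fin_one]
      linear_combination -γ 1 0 * hk)
    rw [hψ] at h
    have h0 : s = 0 := by linear_combination h / 2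
    exact .zero_of_cocycle (h0 ▸ hs)
  · intro hmod h1
    have hψ' : newformPsi χ₁ χ₂ (γ 1 1) = -χ₂ (-1) := by
      rw [h1] at hψ
      linear_combination -χ₂ (-1) * hψ - newformPsi χ₁ χ₂ (γ 1 1) * hε
    -- Likewise `a(d - a) = bc - (a² - 1)`.
    obtain ⟨k, hk⟩ : γ 1 0 ∣ γ 1 1 - γ 0 0 := by
      obtain ⟨e, he⟩ := hmod.symm.dvd
      refine hcop.dvd_of_dvd_mul_left ⟨γ 0 1 - e, ?_⟩
      linear_combination hdet - he
    -- Here `δ` is the reflected matrix, with constant `-χ₂(-1) s`; since `ψ(d) = -χ₂(-1)`, the two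
    -- signs combine to `s = -χ₂(-1)² s = -s`.
    have h := newformF_cocycle_relation χ₁ χ₂ (by rw [hψ', neg_mul_neg, hε]) hs hs' k (by
      simp only [Matrix.SpecialLinearGroup.coe_mul, ModularGroup.coe_T_zpow,
        Matrix.SpecialLinearGroup.coe_inv, Matrix.adjugate_fin_two, Matrix.mul_apply,
        Fin.sum_univ_two, Matrix.of_apply, Matrix.cons_val', Matrix.cons_val_zero,
        Matrix.cons_val_one, Matrix.cons_val_fin_one]
      simp only [SL2Z_reflect, Matrix.of_apply, Matrix.cons_val', Matrix.cons_val_zero,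
        Matrix.cons_val_one, Matrix.cons_val_fin_one]
      linear_combination γ 1 0 * hk)
    rw [hψ'] at h
    have h0 : s = 0 := by linear_combination h / 2 - s / 2 * hε
    exact .zero_of_cocycle (h0 ▸ hs)
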